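/- Let $\mathbb{R}^{1+d}$ ($d\ge 0$ an integer) be Minkowski space with the metric $m=-dt^2+dx_1^2+\dots+dx_d^2$, let $\mathbb{R}$ carry the metric $ds^2$, and let $(N,h)$ be a smooth finite-dimensional Riemannian manifold without boundary. Geodesics are smooth curves $\gamma$ with $\nabla_{\dot\gamma}\dot\gamma=0$ for the Levi-Civita connection (constant curves are allowed). A smooth map $f$ between pseudo-Riemannian manifolds is called totally geodesic if for every geodesic $\gamma:(a,b)\to M$ of the source, $f\circ\gamma:(a,b)\to N$ is a geodesic of the target. A submersion (immersion) is a smooth map whose differential is surjective (injective) at every point. Let $\varphi:(\mathbb{R}^{1+d},m)\to(N,h)$ be a totally geodesic map whose differential $\varphi_*$ has rank $1$ at every point. Then: 1. There are a totally geodesic submersion $\varphi_S:(\mathbb{R}^{1+d},m)\to\mathbb{R}$ and a totally geodesic immersion $\varphi_I:\mathbb{R}\to(N,h)$ such that $\varphi=\varphi_I\circ\varphi_S$. 2. For every such factorization, $\varphi_S$ is an affine function, $\varphi_I$ is a geodesic of $(N,h)$ defined on all of $\mathbb{R}$, and the function $$m(d\varphi_S,d\varphi_S)=-(\partial_t\varphi_S)^2+\sum_{i=1}^d(\partial_{x_i}\varphi_S)^2$$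 is constant on $\mathbb{R}^{1+d}$. 3. Call $\varphi$ time-like, null or space-like if it has a factorization as in 1 with $m(d\varphi_S,d\varphi_S)<0$, $=0$ or $>0$ everywhere, respectively. Then $\varphi$ is exactly one of time-like, null and space-like. -/

import Mathlib

open Set
open scoped Manifold ContDiff

noncomputable section

/-- A smooth pseudo-Riemannian metric on a manifold `M` (without boundary) modelled on `E`. -/
structure PseudoRiemannianMetric (E : Type*) [NormedAddCommGroup E] [NormedSpace ℝ E]
    (M : Type*) [TopologicalSpace M] [ChartedSpace E M] [IsManifold 𝓘(ℝ, E) ∞ M] where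
  /-- The scalar product on each tangent space. -/
  form (x : M) : TangentSpace 𝓘(ℝ, E) x →L[ℝ] TangentSpace 𝓘(ℝ, E) x →L[ℝ] ℝ
  symm (x : M) (v w : TangentSpace 𝓘(ℝ, E) x) : form x v w = form x w v
  nondegenerate (x : M) (v : TangentSpace 𝓘(ℝ, E) x) (hv : ∀ w, form x v w = 0) : v = 0
  contMDiff : ContMDiff 𝓘(ℝ, E) (𝓘(ℝ, E).prod 𝓘(ℝ, E →L[ℝ] E →L[ℝ] ℝ)) ∞
    (fun x ↦ Bundle.TotalSpace.mk' (E →L[ℝ] E →L[ℝ] ℝ)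
      (E := fun x : M ↦ TangentSpace 𝓘(ℝ, E) x →L[ℝ] TangentSpace 𝓘(ℝ, E) x →L[ℝ] ℝ)
      x (form x))

/-- A smooth Riemannian metric, seen as a pseudo-Riemannian metric. -/
def Bundle.ContMDiffRiemannianMetric.toPseudo {E : Type*} [NormedAddCommGroup E] [NormedSpace ℝ E]
    {M : Type*} [TopologicalSpace M] [ChartedSpace E M] [IsManifold 𝓘(ℝ, E) ∞ M]
    (h : Bundle.ContMDiffRiemannianMetric 𝓘(ℝ, E) ∞ E
      (fun x : M ↦ TangentSpace 𝓘(ℝ, E) x)) :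
    PseudoRiemannianMetric E M where
  form := h.inner
  symm := h.symm
  nondegenerate x v hv := by
    by_contra hne
    exact (h.pos x v hne).ne' (hv v)
  contMDiff := h.contMDiff

namespace PseudoRiemannianMetric

section Constant

variable {E : Type*} [NormedAddCommGroup E] [NormedSpace ℝ E]

/-- A bilinear form on a vector space, seen as a bilinear form on each tangent space. -/
def constForm (B : E →L[ℝ] E →L[ℝ] ℝ) (x : E) :
    TangentSpace 𝓘(ℝ, E) x →L[ℝ] TangentSpace 𝓘(ℝ, E) x →L[ℝ] ℝ :=
  B

/-- The constant metric on a vector space given by a nondegenerate symmetric bilinear form. -/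
def const (B : E →L[ℝ] E →L[ℝ] ℝ) (hsymm : ∀ v w, B v w = B w v)
    (hB : ∀ v, (∀ w, B v w = 0) → v = 0) : PseudoRiemannianMetric E E where
  form := constForm B
  symm _ v w := hsymm v w
  nondegenerate _ v hv := hB v hv
  contMDiff := by
    intro x
    rw [Bundle.contMDiffAt_section]
    refine (contMDiffAt_const (c := B)).congr_of_eventuallyEq (Filter.Eventually.of_forall ?_)
    intro y
    ext v w
    simp [hom_trivializationAt_apply, ContinuousLinearMap.inCoordinates]
    rw [Bundle.Trivialization.linearMapAt_apply, if_pos (by simp; exact mem_univ y)]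
    simp [hom_trivializationAt_apply, ContinuousLinearMap.inCoordinates]
    rfl

end Constant

variable {E : Type*} [NormedAddCommGroup E] [NormedSpace ℝ E]
  {M : Type*} [TopologicalSpace M] [ChartedSpace E M] [IsManifold 𝓘(ℝ, E) ∞ M]
  (g : PseudoRiemannianMetric E M)

/-- The coordinate expression `(g_{ij}(y))` of the metric in the chart `e`, at `y ∈ e.target`:
the pull-back of the metric under `e.symm`. -/
def inChart (e : OpenPartialHomeomorph M E) (y : E) : E →L[ℝ] E →L[ℝ] ℝ :=
  let D : E →L[ℝ] TangentSpace 𝓘(ℝ, E) (e.symm y) := mfderiv 𝓘(ℝ, E) 𝓘(ℝ, E) e.symm y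
  (ContinuousLinearMap.precomp ℝ D) ∘L (g.form (e.symm y)) ∘L D

/-- The Christoffel symbols `Γ(y)(u, v) = Γ^k_{ij}(y) u^i v^j ∂_k` of the Levi-Civita connection in
the chart `e`: the vector such that, for all `w`,
`2 g(Γ(u, v), w) = ∂_u g(v, w) + ∂_v g(u, w) - ∂_w g(u, v)`. -/
def christoffel (e : OpenPartialHomeomorph M E) (y u v : E) : E :=
  let dG : E →L[ℝ] E →L[ℝ] E →L[ℝ] ℝ := fderiv ℝ (g.inChart e) y
  (g.inChart e y).inverse ((1 / 2 : ℝ) • (dG u v + dG v u - (dG.flip u).flip v))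

/-- `γ` is a (smooth, affinely parametrized, possibly constant) geodesic on the open set `s` of
parameters: in every chart, `(γ^k)'' + Γ^k_{ij}(γ) (γ^i)' (γ^j)' = 0`. -/
structure IsGeodesicOn (γ : ℝ → M) (s : Set ℝ) : Prop where
  contMDiffOn : ContMDiffOn 𝓘(ℝ, ℝ) 𝓘(ℝ, E) ∞ γ s
  geodesic_eq : ∀ t ∈ s, ∀ e ∈ atlas E M, γ t ∈ e.source →
    deriv (deriv (e ∘ γ)) t
      + g.christoffel e (e (γ t)) (deriv (e ∘ γ) t) (deriv (e ∘ γ) t) = 0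

/-- The scalar product on covectors induced by the metric: `g(α, β) = g^{ij} α_i β_j`. -/
def dual (x : M) (α β : TangentSpace 𝓘(ℝ, E) x →L[ℝ] ℝ) : ℝ :=
  α ((g.form x).inverse β)

end PseudoRiemannianMetric

section Maps

variable {E : Type*} [NormedAddCommGroup E] [NormedSpace ℝ E]
  {M : Type*} [TopologicalSpace M] [ChartedSpace E M] [IsManifold 𝓘(ℝ, E) ∞ M]
  {E' : Type*} [NormedAddCommGroup E'] [NormedSpace ℝ E']
  {N : Type*} [TopologicalSpace N] [ChartedSpace E' N] [IsManifold 𝓘(ℝ, E') ∞ N]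

/-- A smooth map is totally geodesic if it maps geodesics to geodesics. -/
structure IsTotallyGeodesic (g : PseudoRiemannianMetric E M) (h : PseudoRiemannianMetric E' N)
    (f : M → N) : Prop where
  contMDiff : ContMDiff 𝓘(ℝ, E) 𝓘(ℝ, E') ∞ f
  map_geodesic : ∀ (γ : ℝ → M) (a b : ℝ),
    g.IsGeodesicOn γ (Ioo a b) → h.IsGeodesicOn (f ∘ γ) (Ioo a b)

end Maps

/-- The underlying manifold of the Minkowski space `ℝ^{1+d}`; the coordinate `0` is the time. -/
abbrev MinkowskiSpace (d : ℕ) : Type := EuclideanSpace ℝ (Fin (d + 1))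

/-- The Minkowski scalar product `- v_0 w_0 + v_1 w_1 + ⋯ + v_d w_d`. -/
def minkowskiForm (d : ℕ) : MinkowskiSpace d →L[ℝ] MinkowskiSpace d →L[ℝ] ℝ :=
  -(EuclideanSpace.proj (𝕜 := ℝ) (0 : Fin (d + 1))).smulRight
      (EuclideanSpace.proj (𝕜 := ℝ) (0 : Fin (d + 1)))
    + ∑ i : Fin d, (EuclideanSpace.proj (𝕜 := ℝ) i.succ).smulRight
        (EuclideanSpace.proj (𝕜 := ℝ) i.succ)

lemma minkowskiForm_apply (d : ℕ) (v w : MinkowskiSpace d) :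
    minkowskiForm d v w = -(v 0 * w 0) + ∑ i : Fin d, v i.succ * w i.succ := by
  simp [minkowskiForm]

/-- The Minkowski metric `m = -dt² + dx_1² + ⋯ + dx_d²`. -/
def minkowskiMetric (d : ℕ) : PseudoRiemannianMetric (MinkowskiSpace d) (MinkowskiSpace d) :=
  .const (minkowskiForm d)
    (fun v w ↦ by simp only [minkowskiForm_apply, mul_comm])
    (fun v hv ↦ by
      ext i
      have h := hv (EuclideanSpace.single i 1)
      rw [minkowskiForm_apply] at h
      refine Fin.cases (fun h ↦ ?_) (fun j h ↦ ?_) i h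
      · simpa [Fin.succ_ne_zero] using h
      · simpa [(Fin.succ_ne_zero _).symm] using h)

/-- The standard scalar product of the real line. -/
def realForm : ℝ →L[ℝ] ℝ →L[ℝ] ℝ := ContinuousLinearMap.mul ℝ ℝ

lemma realForm_apply (v w : ℝ) : realForm v w = v * w := rfl

lemma realForm_symm (v w : ℝ) : realForm v w = realForm w v := mul_comm v w

lemma realForm_nondegenerate (v : ℝ) (hv : ∀ w, realForm v w = 0) : v = 0 := by
  simpa [realForm_apply] using hv 1

/-- The standard metric `ds²` of the real line. -/
def realMetric : PseudoRiemannianMetric ℝ ℝ :=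
  .const realForm realForm_symm realForm_nondegenerate

section Factorization

variable {E : Type*} [NormedAddCommGroup E] [NormedSpace ℝ E]
  {N : Type*} [TopologicalSpace N] [ChartedSpace E N] [IsManifold 𝓘(ℝ, E) ∞ N]
  {d : ℕ}

/-- `φ = φI ∘ φS`, where `φS : ℝ^{1+d} → ℝ` is a totally geodesic submersion and `φI : ℝ → N` is a
totally geodesic immersion. -/
structure IsTotallyGeodesicFactorization (h : PseudoRiemannianMetric E N)
    (φ : MinkowskiSpace d → N) (φS : MinkowskiSpace d → ℝ) (φI : ℝ → N) : Prop where
  eq_comp : φ = φI ∘ φS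
  totallyGeodesic_fst : IsTotallyGeodesic (minkowskiMetric d) realMetric φS
  submersion : ∀ x, Function.Surjective (mfderiv 𝓘(ℝ, MinkowskiSpace d) 𝓘(ℝ, ℝ) φS x)
  totallyGeodesic_snd : IsTotallyGeodesic realMetric h φI
  immersion : ∀ s, Function.Injective (mfderiv 𝓘(ℝ, ℝ) 𝓘(ℝ, E) φI s)

/-- The value at `x` of the function `m(dφS, dφS)`. -/
def minkowskiDifferentialSq (φS : MinkowskiSpace d → ℝ) (x : MinkowskiSpace d) : ℝ :=
  (minkowskiMetric d).dual x (fderiv ℝ φS x) (fderiv ℝ φS x)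

/-- `φ` is time-like: it factors with a time-like differential `dφS`. -/
def IsTimeLike (h : PseudoRiemannianMetric E N) (φ : MinkowskiSpace d → N) : Prop :=
  ∃ φS φI, IsTotallyGeodesicFactorization h φ φS φI ∧ ∀ x, minkowskiDifferentialSq φS x < 0

/-- `φ` is null: it factors with a null differential `dφS`. -/
def IsNull (h : PseudoRiemannianMetric E N) (φ : MinkowskiSpace d → N) : Prop :=
  ∃ φS φI, IsTotallyGeodesicFactorization h φ φS φI ∧ ∀ x, minkowskiDifferentialSq φS x = 0

/-- `φ` is space-like: it factors with a space-like differential `dφS`. -/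
def IsSpaceLike (h : PseudoRiemannianMetric E N) (φ : MinkowskiSpace d → N) : Prop :=
  ∃ φS φI, IsTotallyGeodesicFactorization h φ φS φI ∧ ∀ x, 0 < minkowskiDifferentialSq φS x

end Factorization

end

/-! Straight lines are the geodesics of a flat metric, so in a chart of `N` the map `F = e ∘ φ`
satisfies `D²F(v, v) + Γ(DF v, DF v) = 0`. If `DF w = 0`, comparing `v + w` with `v` gives `D²F(v,
w) = 0` for every `v`. Since `DF` has rank one, this forces `ker DF` to be locally constant
(`eventually_fderiv_apply_eq_zero`), and by connectedness `ker dφ` is one fixed hyperplane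
(`mfderiv_apply_eq_zero_of_map_line`). Hence `φ` is constant along that hyperplane and factors
through a linear form with this kernel, the other factor being `φ` on a transversal line.

For any factorization, `φS` has zero second derivative along lines, hence is affine. Since `dφI` is
injective, `ker dφS = ker dφ`; so `dφS` is unique up to a nonzero scalar, `m(dφS, dφS)` up to a
positive one, and its sign depends on `φ` alone. -/

namespace PseudoRiemannianMetric

/-! ### Geodesics of constant metrics -/

section Flat

variable {E : Type*} [NormedAddCommGroup E] [NormedSpace ℝ E]
  {F : Type*} [NormedAddCommGroup F] [NormedSpace ℝ F]

lemma christoffel_zero_zero {M : Type*} [TopologicalSpace M] [ChartedSpace E M]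
    [IsManifold 𝓘(ℝ, E) ∞ M] (g : PseudoRiemannianMetric E M) (e : OpenPartialHomeomorph M E)
    (y : E) : g.christoffel e y 0 0 = 0 := by
  simp [christoffel]

lemma christoffel_const (B : E →L[ℝ] E →L[ℝ] ℝ) (hsymm : ∀ v w, B v w = B w v)
    (hB : ∀ v, (∀ w, B v w = 0) → v = 0) (y u v : E) :
    (const B hsymm hB).christoffel (OpenPartialHomeomorph.refl E) y u v = 0 := by
  have h : (const B hsymm hB).inChart (OpenPartialHomeomorph.refl E) = fun _ ↦ B := by
    funext z
    ext a b
    have hD : mfderiv 𝓘(ℝ, E) 𝓘(ℝ, E) (OpenPartialHomeomorph.refl E).symm z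
        = ContinuousLinearMap.id ℝ (TangentSpace 𝓘(ℝ, E) z) := mfderiv_id
    simp only [inChart]
    rw [hD]
    rfl
  simp [christoffel, h]

lemma isGeodesicOn_const_iff (B : E →L[ℝ] E →L[ℝ] ℝ) (hsymm : ∀ v w, B v w = B w v)
    (hB : ∀ v, (∀ w, B v w = 0) → v = 0) (γ : ℝ → E) (s : Set ℝ) :
    (const B hsymm hB).IsGeodesicOn γ s ↔
      ContDiffOn ℝ ∞ γ s ∧ ∀ t ∈ s, deriv (deriv γ) t = 0 := by
  constructor
  · rintro ⟨h1, h2⟩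
    refine ⟨contMDiffOn_iff_contDiffOn.1 h1, fun t ht ↦ ?_⟩
    have := h2 t ht (OpenPartialHomeomorph.refl E) (by simp) (by simp)
    rw [christoffel_const, add_zero] at this
    exact this
  · rintro ⟨h1, h2⟩
    refine ⟨contMDiffOn_iff_contDiffOn.2 h1, fun t ht e he _ ↦ ?_⟩
    -- The atlas of the model space contains only the identity chart.
    rw [chartedSpaceSelf_atlas] at he
    subst he
    rw [christoffel_const, add_zero]
    exact h2 t ht

/-- Continuous linear maps between flat spaces map geodesics to geodesics. -/
lemma IsGeodesicOn.clm_comp {B : E →L[ℝ] E →L[ℝ] ℝ} {hsymm : ∀ v w, B v w = B w v}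
    {hB : ∀ v, (∀ w, B v w = 0) → v = 0} {B' : F →L[ℝ] F →L[ℝ] ℝ}
    {hsymm' : ∀ v w, B' v w = B' w v} {hB' : ∀ v, (∀ w, B' v w = 0) → v = 0}
    {γ : ℝ → E} {s : Set ℝ} (hs : IsOpen s)
    (hγ : (const B hsymm hB).IsGeodesicOn γ s) (L : E →L[ℝ] F) :
    (const B' hsymm' hB').IsGeodesicOn (L ∘ γ) s := by
  rw [isGeodesicOn_const_iff] at hγ ⊢
  obtain ⟨h1, h2⟩ := hγ
  refine ⟨L.contDiff.comp_contDiffOn h1, fun t ht ↦ ?_⟩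
  have hd : ∀ r ∈ s, deriv (L ∘ γ) r = L (deriv γ r) := fun r hr ↦
    (L.hasFDerivAt.comp_hasDerivAt r
      ((h1.contDiffAt (hs.mem_nhds hr)).differentiableAt (by simp)).hasDerivAt).deriv
  have hdd : DifferentiableAt ℝ (deriv γ) t :=
    ((h1.deriv_of_isOpen (m := 1) hs (by norm_cast)).contDiffAt
      (hs.mem_nhds ht)).differentiableAt (by simp)
  have he : deriv (L ∘ γ) =ᶠ[nhds t] fun r ↦ L (deriv γ r) :=
    Filter.eventually_of_mem (hs.mem_nhds ht) hd
  rw [he.deriv_eq]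
  have := (L.hasFDerivAt.comp_hasDerivAt t hdd.hasDerivAt).deriv
  rw [h2 t ht, map_zero] at this
  exact this

lemma isGeodesicOn_const_line (B : E →L[ℝ] E →L[ℝ] ℝ) (hsymm : ∀ v w, B v w = B w v)
    (hB : ∀ v, (∀ w, B v w = 0) → v = 0) (x v : E) (s : Set ℝ) :
    (const B hsymm hB).IsGeodesicOn (fun t ↦ x + t • v) s := by
  rw [isGeodesicOn_const_iff]
  refine ⟨ContDiff.contDiffOn (by fun_prop), fun t _ ↦ ?_⟩
  have h : deriv (fun t : ℝ ↦ x + t • v) = fun _ ↦ v := by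
    funext r
    simpa using (((hasDerivAt_id r).smul_const v).const_add x).deriv
  rw [h, deriv_const]

end Flat

end PseudoRiemannianMetric

/-! ### Calculus in normed spaces: rank-one differentials and affine functions -/

section Calculus

variable {V : Type*} [NormedAddCommGroup V] [NormedSpace ℝ V]
  {E : Type*} [NormedAddCommGroup E] [NormedSpace ℝ E]

/-- The second derivative of `f` along the line `t ↦ x + t v`. -/
lemma ContDiffOn.deriv_deriv_comp_line {f : V → E} {U : Set V} (hU : IsOpen U)
    (hf : ContDiffOn ℝ ∞ f U) {x : V} (hx : x ∈ U) (v : V) :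
    deriv (fun t : ℝ ↦ f (x + t • v)) 0 = fderiv ℝ f x v ∧
    deriv (deriv (fun t : ℝ ↦ f (x + t • v))) 0 = fderiv ℝ (fderiv ℝ f) x v v := by
  have hl : ∀ t : ℝ, HasDerivAt (fun t : ℝ ↦ x + t • v) v t := fun t ↦ by
    simpa using ((hasDerivAt_id t).smul_const v).const_add x
  have hd : ∀ t : ℝ, x + t • v ∈ U →
      deriv (fun t : ℝ ↦ f (x + t • v)) t = fderiv ℝ f (x + t • v) v := fun t ht ↦
    (((hf.contDiffAt (hU.mem_nhds ht)).differentiableAt (by simp)).hasFDerivAt.comp_hasDerivAt t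
      (hl t)).deriv
  have h0 : x + (0 : ℝ) • v = x := by simp
  have hev : deriv (fun t : ℝ ↦ f (x + t • v)) =ᶠ[nhds 0] fun t ↦ fderiv ℝ f (x + t • v) v := by
    have : ∀ᶠ t : ℝ in nhds 0, x + t • v ∈ U :=
      (hl 0).continuousAt.eventually_mem (hU.mem_nhds (by rwa [h0]))
    exact this.mono hd
  refine ⟨by rw [hd 0 (by rwa [h0]), h0], ?_⟩
  rw [hev.deriv_eq]
  have h2 : DifferentiableAt ℝ (fderiv ℝ f) (x + (0 : ℝ) • v) := by
    rw [h0]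
    exact ((hf.contDiffAt (hU.mem_nhds hx)).fderiv_right (m := 1) (by norm_cast)).differentiableAt
      (by simp)
  have h3 := h2.hasFDerivAt.comp_hasDerivAt (0 : ℝ) (hl 0)
  rw [h0] at h3
  exact (h3.clm_apply (hasDerivAt_const (0 : ℝ) v)).deriv.trans (by simp)

/-- If the differential of `f` has rank one and its kernel is contained in the kernel of the
second derivative, then the kernel is locally constant. -/
lemma eventually_fderiv_apply_eq_zero {f : V → E} {U : Set V} (hU : IsOpen U)
    (hf : ContDiffOn ℝ ∞ f U)
    (hker : ∀ y ∈ U, ∀ w, fderiv ℝ f y w = 0 → ∀ v, fderiv ℝ (fderiv ℝ f) y v w = 0)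
    (hrank : ∀ y ∈ U, ∀ u w, fderiv ℝ f y u ≠ 0 → ∃ c : ℝ, fderiv ℝ f y w = c • fderiv ℝ f y u)
    {x : V} (hx : x ∈ U) {u w : V} (hu : fderiv ℝ f x u ≠ 0) (hw : fderiv ℝ f x w = 0) :
    ∀ᶠ y in nhds x, fderiv ℝ f y w = 0 := by
  -- Near `x` the functional `l` does not vanish on `DF u`, so `l (DF w) / l (DF u)` is the
  -- coefficient of `DF w` along `DF u`.
  obtain ⟨l, hl⟩ := SeparatingDual.exists_eq_one (R := ℝ) hu
  have hD : ContDiffOn ℝ 1 (fderiv ℝ f) U := hf.fderiv_of_isOpen hU (by norm_cast)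
  have hDa : ∀ y ∈ U, ∀ z, HasFDerivAt (fun y ↦ l (fderiv ℝ f y z))
      (l ∘L ((fderiv ℝ (fderiv ℝ f) y).flip z)) y := fun y hy z ↦
    l.hasFDerivAt.comp y ((((hD.contDiffAt (hU.mem_nhds hy)).differentiableAt
      (by simp)).hasFDerivAt.clm_apply (hasFDerivAt_const z y)).congr_fderiv (by ext; simp))
  have hne : ∀ᶠ y in nhds x, y ∈ U ∧ l (fderiv ℝ f y u) ≠ 0 :=
    (hU.eventually_mem hx).and ((hDa x hx u).continuousAt.eventually_ne (by simp [hl]))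
  obtain ⟨r, hr, hball⟩ := Metric.eventually_nhds_iff_ball.1 hne
  have hfrac : ∀ y ∈ Metric.ball x r, fderiv ℝ f y w =
      (l (fderiv ℝ f y w) / l (fderiv ℝ f y u)) • fderiv ℝ f y u := fun y hy ↦ by
    obtain ⟨hyU, hyu⟩ := hball y hy
    obtain ⟨c, hc⟩ := hrank y hyU u w (fun h0 ↦ hyu (by rw [h0, map_zero]))
    rw [hc, map_smul, smul_eq_mul, mul_div_cancel_right₀ _ hyu]
  have hderiv : ∀ y ∈ Metric.ball x r,
      HasFDerivAt (fun y ↦ l (fderiv ℝ f y w) / l (fderiv ℝ f y u)) (0 : V →L[ℝ] ℝ) y := by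
    intro y hy
    obtain ⟨hyU, hyu⟩ := hball y hy
    simp only [div_eq_mul_inv]
    refine ((hDa y hyU w).fun_mul
      ((hasDerivAt_inv hyu).comp_hasFDerivAt y (hDa y hyU u))).congr_fderiv ?_
    ext v
    -- This vector lies in the kernel at `y`, so `D²F(v, ·)` kills it; this is exactly the vanishing
    -- of the numerator in the quotient rule.
    have h1 := hker y hyU (w - (l (fderiv ℝ f y w) / l (fderiv ℝ f y u)) • u)
      (by rw [map_sub, map_smul, ← hfrac y hy, sub_self]) v
    have h2 := congrArg l h1
    simp only [map_sub, map_smul, map_zero, smul_eq_mul] at h2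
    have h3 : l (fderiv ℝ (fderiv ℝ f) y v w)
        = l (fderiv ℝ f y w) / l (fderiv ℝ f y u) * l (fderiv ℝ (fderiv ℝ f) y v u) := by linarith
    simp [h3]
    field_simp
    simp
  have hconst : ∀ y ∈ Metric.ball x r,
      l (fderiv ℝ f y w) / l (fderiv ℝ f y u) = l (fderiv ℝ f x w) / l (fderiv ℝ f x u) :=
    fun y hy ↦ Metric.isOpen_ball.is_const_of_fderiv_eq_zero
      (convex_ball x r).isPreconnected
      (fun z hz ↦ (hderiv z hz).differentiableAt.differentiableWithinAt)
      (fun z hz ↦ (hderiv z hz).fderiv) hy (Metric.mem_ball_self hr)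
  filter_upwards [Metric.ball_mem_nhds x hr] with y hy
  rw [hfrac y hy, hconst y hy, hw]
  simp

/-- A function with vanishing second derivative along every line is affine. -/
lemma eq_add_fderiv_of_deriv_deriv_eq_zero {f : V → E} (hf : ContDiff ℝ ∞ f)
    (h : ∀ v t, deriv (deriv fun t : ℝ ↦ f (t • v)) t = 0) (v : V) :
    f v = f 0 + fderiv ℝ f 0 v := by
  have hs : ContDiff ℝ ∞ fun t : ℝ ↦ f (t • v) := hf.comp (by fun_prop)
  have hs' : Differentiable ℝ (deriv fun t : ℝ ↦ f (t • v)) :=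
    (contDiff_infty_iff_deriv.1 hs).2.differentiable (by simp)
  have h0 := (hf.contDiffOn.deriv_deriv_comp_line isOpen_univ (mem_univ (0 : V)) v).1
  simp only [zero_add] at h0
  have h1 : ∀ t, deriv (fun t : ℝ ↦ f (t • v)) t = fderiv ℝ f 0 v := fun t ↦ by
    rw [← h0]
    exact is_const_of_deriv_eq_zero hs' (h v) t 0
  have h2 : ∀ t : ℝ, HasDerivAt (fun t : ℝ ↦ f (t • v) - t • fderiv ℝ f 0 v) 0 t := fun t ↦ by
    have ha := (hs.differentiable (by simp) t).hasDerivAt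
    rw [h1 t] at ha
    simpa using ha.fun_sub ((hasDerivAt_id t).smul_const (fderiv ℝ f 0 v))
  have h3 := is_const_of_deriv_eq_zero (fun t ↦ (h2 t).differentiableAt)
    (fun t ↦ (h2 t).deriv) 1 0
  simp only [one_smul, zero_smul, sub_zero] at h3
  exact sub_eq_iff_eq_add.1 h3

end Calculus

/-! ### Parallelism of the kernel, through charts of the target -/

section Chart

variable {V : Type*} [NormedAddCommGroup V] [NormedSpace ℝ V]
  {E : Type*} [NormedAddCommGroup E] [NormedSpace ℝ E]
  {N : Type*} [TopologicalSpace N] [ChartedSpace E N] [IsManifold 𝓘(ℝ, E) ∞ N]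

lemma ContMDiff.contDiffOn_chart_comp {φ : V → N} (hφ : ContMDiff 𝓘(ℝ, V) 𝓘(ℝ, E) ∞ φ) (p : N) :
    ContDiffOn ℝ ∞ (chartAt E p ∘ φ) (φ ⁻¹' (chartAt E p).source) :=
  contMDiffOn_iff_contDiffOn.1
    ((contMDiffOn_chart (I := 𝓘(ℝ, E)) (n := ∞) (x := p)).comp hφ.contMDiffOn (fun _ hx ↦ hx))

/-- The differential of a map read in a chart vanishes on the same vectors, and satisfies the same
proportionality relations, as the differential of the map. -/
lemma ContMDiff.fderiv_chart_comp {φ : V → N} (hφ : ContMDiff 𝓘(ℝ, V) 𝓘(ℝ, E) ∞ φ) (p : N)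
    {y : V} (hy : φ y ∈ (chartAt E p).source) :
    ∃ A : E →L[ℝ] E, Function.Injective A ∧
      ∀ v : V, fderiv ℝ (chartAt E p ∘ φ) y v = A (mfderiv 𝓘(ℝ, V) 𝓘(ℝ, E) φ y v) := by
  have he := mdifferentiable_chart (I := 𝓘(ℝ, E)) p
  refine ⟨mfderiv 𝓘(ℝ, E) 𝓘(ℝ, E) (chartAt E p) (φ y), he.mfderiv_injective hy, fun v ↦ ?_⟩
  rw [← mfderiv_eq_fderiv, mfderiv_comp y (he.mdifferentiableAt hy) (hφ.mdifferentiable (by simp) y)]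
  rfl

variable {φ : V → N}

/-- The kernel of the differential of a map of rank one that maps lines to geodesics is constant. -/
lemma mfderiv_apply_eq_zero_of_map_line (h : PseudoRiemannianMetric E N)
    (hφ : ContMDiff 𝓘(ℝ, V) 𝓘(ℝ, E) ∞ φ)
    (hline : ∀ x v : V, h.IsGeodesicOn (fun t : ℝ ↦ φ (x + t • v)) (Ioo (-1) 1))
    (hrank : ∀ x, Module.finrank ℝ (mfderiv 𝓘(ℝ, V) 𝓘(ℝ, E) φ x).range = 1)
    {x : V} {w : V} (hw : mfderiv 𝓘(ℝ, V) 𝓘(ℝ, E) φ x w = 0) (y : V) :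
    mfderiv 𝓘(ℝ, V) 𝓘(ℝ, E) φ y w = 0 := by
  have hprop : ∀ y, ∀ u w : V, mfderiv 𝓘(ℝ, V) 𝓘(ℝ, E) φ y u ≠ 0 →
      ∃ c : ℝ, mfderiv 𝓘(ℝ, V) 𝓘(ℝ, E) φ y w = c • mfderiv 𝓘(ℝ, V) 𝓘(ℝ, E) φ y u := by
    intro y u w hu
    obtain ⟨c, hc⟩ := (finrank_eq_one_iff_of_nonzero'
      (⟨_, u, rfl⟩ : (mfderiv 𝓘(ℝ, V) 𝓘(ℝ, E) φ y).range)
      (fun h0 ↦ hu (congrArg Subtype.val h0))).1 (hrank y) ⟨_, w, rfl⟩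
    exact ⟨c, (congrArg Subtype.val hc).symm⟩
  have hex : ∀ y, ∃ u : V, mfderiv 𝓘(ℝ, V) 𝓘(ℝ, E) φ y u ≠ 0 := by
    intro y
    obtain ⟨⟨_, u, rfl⟩, hne, -⟩ := finrank_eq_one_iff'.1 (hrank y)
    exact ⟨u, fun h0 ↦ hne (Subtype.ext h0)⟩
  have hker : ∀ p : N, ∀ y ∈ φ ⁻¹' (chartAt E p).source, ∀ w,
      fderiv ℝ (chartAt E p ∘ φ) y w = 0 → ∀ v,
      fderiv ℝ (fderiv ℝ (chartAt E p ∘ φ)) y v w = 0 := by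
    intro p y hy w hw v
    have hU : IsOpen (φ ⁻¹' (chartAt E p).source) := (chartAt E p).open_source.preimage hφ.continuous
    have hF := hφ.contDiffOn_chart_comp p
    set Γ : E → E := fun z ↦ h.christoffel (chartAt E p) (chartAt E p (φ y)) z z
    have hQ : ∀ v, fderiv ℝ (fderiv ℝ (chartAt E p ∘ φ)) y v v
        + Γ (fderiv ℝ (chartAt E p ∘ φ) y v) = 0 := by
      intro v
      obtain ⟨h1, h2⟩ := hF.deriv_deriv_comp_line hU hy v
      have h3 := (hline y v).geodesic_eq 0 (by norm_num) _ (chart_mem_atlas E p) (by simpa using hy)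
      rw [← h1, ← h2]
      simpa [Γ, Function.comp_def] using h3
    have hsymm : IsSymmSndFDerivAt ℝ (chartAt E p ∘ φ) y :=
      (hF.contDiffAt (hU.mem_nhds hy)).isSymmSndFDerivAt (by simp; norm_cast)
    have ha := hQ v
    have hb := hQ w
    have hc := hQ (v + w)
    -- The Christoffel terms at `v` and `v + w` agree because `DF w = 0`; so `Γ 0 = 0` suffices and
    -- bilinearity plays no role.
    have h0 : Γ 0 = 0 := h.christoffel_zero_zero _ _
    rw [hw, h0, add_zero] at hb
    simp only [map_add, _root_.add_apply, hw, add_zero, hb, hsymm.eq w v] at hc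
    have h2 : (2 : ℝ) • fderiv ℝ (fderiv ℝ (chartAt E p ∘ φ)) y v w = 0 := by
      rw [two_smul, ← sub_eq_zero.2 (hc.trans ha.symm)]
      abel
    simpa using h2
  have hiff : ∀ p : N, ∀ y ∈ φ ⁻¹' (chartAt E p).source, ∀ w,
      fderiv ℝ (chartAt E p ∘ φ) y w = 0 ↔ mfderiv 𝓘(ℝ, V) 𝓘(ℝ, E) φ y w = 0 := by
    intro p y hy w
    obtain ⟨A, hA, hAv⟩ := hφ.fderiv_chart_comp p hy
    rw [hAv]
    exact map_eq_zero_iff A hA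
  -- Closed by continuity of the differential, open by local constancy of the kernel.
  have hclopen : IsClopen {y | mfderiv 𝓘(ℝ, V) 𝓘(ℝ, E) φ y w = 0} := by
    constructor
    · rw [← isOpen_compl_iff, isOpen_iff_mem_nhds]
      intro y hy
      have hU : IsOpen (φ ⁻¹' (chartAt E (φ y)).source) :=
        (chartAt E (φ y)).open_source.preimage hφ.continuous
      have hyU : y ∈ φ ⁻¹' (chartAt E (φ y)).source := mem_chart_source E (φ y)
      have hcont : ContinuousAt (fun z ↦ fderiv ℝ (chartAt E (φ y) ∘ φ) z w) y :=
        ((((hφ.contDiffOn_chart_comp (φ y)).contDiffAt (hU.mem_nhds hyU)).fderiv_right (m := 0)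
          (by simp)).continuousAt).clm_apply continuousAt_const
      filter_upwards [hcont.eventually_ne (fun h0 ↦ hy ((hiff _ y hyU w).1 h0)),
        hU.mem_nhds hyU] with z hz hzU h0
      exact hz ((hiff _ z hzU w).2 h0)
    · rw [isOpen_iff_mem_nhds]
      intro y hy
      have hU : IsOpen (φ ⁻¹' (chartAt E (φ y)).source) :=
        (chartAt E (φ y)).open_source.preimage hφ.continuous
      have hyU : y ∈ φ ⁻¹' (chartAt E (φ y)).source := mem_chart_source E (φ y)
      obtain ⟨u, hu⟩ := hex y
      have hr : ∀ z ∈ φ ⁻¹' (chartAt E (φ y)).source, ∀ u w,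
          fderiv ℝ (chartAt E (φ y) ∘ φ) z u ≠ 0 →
          ∃ c : ℝ, fderiv ℝ (chartAt E (φ y) ∘ φ) z w
            = c • fderiv ℝ (chartAt E (φ y) ∘ φ) z u := by
        intro z hz u w hzu
        obtain ⟨c, hc⟩ := hprop z u w (fun h0 ↦ hzu ((hiff _ z hz u).2 h0))
        obtain ⟨A, -, hAv⟩ := hφ.fderiv_chart_comp (φ y) hz
        refine ⟨c, ?_⟩
        rw [hAv, hAv, hc]
        exact map_smul A c _
      filter_upwards [eventually_fderiv_apply_eq_zero hU (hφ.contDiffOn_chart_comp (φ y))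
        (hker (φ y)) hr hyU (fun h0 ↦ hu ((hiff _ y hyU u).1 h0)) ((hiff _ y hyU w).2 hy),
        hU.mem_nhds hyU] with z hz hzU
      exact (hiff _ z hzU w).1 hz
  have := hclopen.eq_univ ⟨x, hw⟩
  exact this.ge (mem_univ y)

/-- A map into a manifold is constant along a direction in which its differential vanishes. -/
lemma ContMDiff.eq_of_mfderiv_apply_eq_zero (hφ : ContMDiff 𝓘(ℝ, V) 𝓘(ℝ, E) ∞ φ) {w : V}
    (hw : ∀ y, mfderiv 𝓘(ℝ, V) 𝓘(ℝ, E) φ y w = 0) (x : V) : φ (x + w) = φ x := by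
  have hl : ∀ t : ℝ, HasDerivAt (fun t : ℝ ↦ x + t • w) w t := fun t ↦ by
    simpa using ((hasDerivAt_id t).smul_const w).const_add x
  -- In a chart the derivative along the line is zero, and charts are injective; connectedness of
  -- `ℝ` then links `t = 0` to `t = 1`.
  have hloc : IsLocallyConstant fun t : ℝ ↦ φ (x + t • w) := by
    rw [IsLocallyConstant.iff_eventually_eq]
    intro t
    set e := chartAt E (φ (x + t • w)) with he
    have hU : IsOpen (φ ⁻¹' e.source) := e.open_source.preimage hφ.continuous
    have hmem : ∀ᶠ s in nhds t, x + s • w ∈ φ ⁻¹' e.source :=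
      (hl t).continuousAt.eventually_mem (hU.mem_nhds (mem_chart_source E _))
    obtain ⟨r, hr, hball⟩ := Metric.eventually_nhds_iff_ball.1 hmem
    have hderiv : ∀ s ∈ Metric.ball t r,
        HasDerivAt (fun s : ℝ ↦ (e ∘ φ) (x + s • w)) 0 s := by
      intro s hs
      obtain ⟨A, -, hAv⟩ := hφ.fderiv_chart_comp (φ (x + t • w)) (hball s hs)
      have h1 := ((((hφ.contDiffOn_chart_comp (φ (x + t • w))).contDiffAt
        (hU.mem_nhds (hball s hs))).differentiableAt (by simp)).hasFDerivAt).comp_hasDerivAt s (hl s)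
      rw [hAv, hw] at h1
      exact h1.congr_deriv (map_zero A)
    filter_upwards [Metric.ball_mem_nhds t hr] with s hs
    refine e.injOn (hball s hs) (mem_chart_source E _) ?_
    exact Metric.isOpen_ball.is_const_of_deriv_eq_zero (convex_ball t r).isPreconnected
      (fun z hz ↦ (hderiv z hz).differentiableAt.differentiableWithinAt)
      (fun z hz ↦ (hderiv z hz).deriv) hs (Metric.mem_ball_self hr)
  simpa using hloc.apply_eq_of_isPreconnected isPreconnected_univ (mem_univ (1 : ℝ)) (mem_univ 0)

end Chart

/-! ### Existence of the factorization and invariance of its causal type -/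

section Factorization

variable {E : Type*} [NormedAddCommGroup E] [NormedSpace ℝ E]
  {N : Type*} [TopologicalSpace N] [ChartedSpace E N] [IsManifold 𝓘(ℝ, E) ∞ N]
  {d : ℕ} {h : PseudoRiemannianMetric E N} {φ : MinkowskiSpace d → N}
  {φS φS' : MinkowskiSpace d → ℝ} {φI φI' : ℝ → N}

/-- A totally geodesic map of rank one factors through a linear form. -/
lemma exists_isTotallyGeodesicFactorization
    (hφ : IsTotallyGeodesic (minkowskiMetric d) h φ)
    (hrank : ∀ x, Module.finrank ℝ
      (mfderiv 𝓘(ℝ, MinkowskiSpace d) 𝓘(ℝ, E) φ x).range = 1) :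
    ∃ φS φI, IsTotallyGeodesicFactorization h φ φS φI := by
  have hpar : ∀ w : MinkowskiSpace d, mfderiv 𝓘(ℝ, MinkowskiSpace d) 𝓘(ℝ, E) φ 0 w = 0 →
      ∀ y, mfderiv 𝓘(ℝ, MinkowskiSpace d) 𝓘(ℝ, E) φ y w = 0 := fun w hw y ↦
    mfderiv_apply_eq_zero_of_map_line h hφ.contMDiff (fun x v ↦ hφ.map_geodesic _ _ _
      (PseudoRiemannianMetric.isGeodesicOn_const_line _ _ _ x v _)) hrank hw y
  have hpar' : ∀ (w : MinkowskiSpace d) y, mfderiv 𝓘(ℝ, MinkowskiSpace d) 𝓘(ℝ, E) φ y w = 0 →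
      mfderiv 𝓘(ℝ, MinkowskiSpace d) 𝓘(ℝ, E) φ 0 w = 0 := fun w y hw ↦
    mfderiv_apply_eq_zero_of_map_line h hφ.contMDiff (fun x v ↦ hφ.map_geodesic _ _ _
      (PseudoRiemannianMetric.isGeodesicOn_const_line _ _ _ x v _)) hrank hw 0
  let D : MinkowskiSpace d →L[ℝ] E := mfderiv 𝓘(ℝ, MinkowskiSpace d) 𝓘(ℝ, E) φ 0
  obtain ⟨u, hu, hspan⟩ : ∃ u : MinkowskiSpace d, D u ≠ 0 ∧
      ∀ w : MinkowskiSpace d, ∃ c : ℝ, c • D u = D w := by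
    obtain ⟨⟨_, u, rfl⟩, hne, hspan⟩ := finrank_eq_one_iff'.1 (hrank 0)
    exact ⟨u, fun h0 ↦ hne (Subtype.ext h0),
      fun w ↦ (hspan ⟨_, w, rfl⟩).imp fun c hc ↦ congrArg Subtype.val hc⟩
  obtain ⟨l, hl⟩ := SeparatingDual.exists_eq_one (R := ℝ) hu
  have hlu : (l ∘L D) u = 1 := hl
  -- The range of `D` is the line through `D u` and `l (D u) = 1`: thus `l ∘L D` projects along `ker
  -- D` onto the coordinate of `u`.
  have hD : ∀ w, D (w - (l ∘L D) w • u) = 0 := fun w ↦ by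
    obtain ⟨c, hc⟩ := hspan w
    have h1 : (l ∘L D) w = c := by simp [← hc, hl]
    rw [map_sub, map_smul, h1, hc, sub_self]
  let L : ℝ →L[ℝ] MinkowskiSpace d := (ContinuousLinearMap.id ℝ ℝ).smulRight u
  refine ⟨l ∘L D, φ ∘ L, ?_, ⟨?_, ?_⟩, ?_, ⟨?_, ?_⟩, ?_⟩
  · funext x
    have h1 := hφ.contMDiff.eq_of_mfderiv_apply_eq_zero (hpar _ (hD x)) ((l ∘L D) x • u)
    rw [add_sub_cancel] at h1
    exact h1
  · exact (l ∘L D).contDiff.contMDiff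
  · exact fun γ a b hγ ↦ hγ.clm_comp isOpen_Ioo (l ∘L D)
  · intro x
    rw [mfderiv_eq_fderiv, (l ∘L D).fderiv]
    have hsurj : Function.Surjective (l ∘L D) := fun c ↦
      ⟨c • u, by rw [map_smul, hlu, smul_eq_mul, mul_one]⟩
    exact hsurj
  · exact hφ.contMDiff.comp L.contDiff.contMDiff
  · exact fun γ a b hγ ↦ hφ.map_geodesic (L ∘ γ) a b (hγ.clm_comp isOpen_Ioo L)
  · intro s
    rw [mfderiv_comp s (hφ.contMDiff.mdifferentiable (by simp) _)
      (L.contDiff.contMDiff.mdifferentiable (n := ∞) (by simp) _), mfderiv_eq_fderiv, L.fderiv]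
    refine (injective_iff_map_eq_zero _).2 fun (c : ℝ) hc ↦ ?_
    -- The kernel at `L s` is the kernel at `0`, and `u` is transversal to it.
    have h1 : D (c • u) = 0 := hpar' (L c) (L s) hc
    rw [map_smul] at h1
    exact (smul_eq_zero.1 h1).resolve_right hu

lemma minkowskiDifferentialSq_def (φS : MinkowskiSpace d → ℝ) (x : MinkowskiSpace d) :
    minkowskiDifferentialSq φS x
      = fderiv ℝ φS x ((minkowskiForm d).inverse (fderiv ℝ φS x)) :=
  rfl

namespace IsTotallyGeodesicFactorization

lemma apply_eq (hf : IsTotallyGeodesicFactorization h φ φS φI) (v : MinkowskiSpace d) :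
    φS v = φS 0 + fderiv ℝ φS 0 v := by
  refine eq_add_fderiv_of_deriv_deriv_eq_zero
    (contMDiff_iff_contDiff.1 hf.totallyGeodesic_fst.contMDiff) (fun v t ↦ ?_) v
  -- Total geodesy speaks of bounded intervals, so each time `t` gets its own.
  have h1 := hf.totallyGeodesic_fst.map_geodesic (fun t ↦ 0 + t • v) (t - 1) (t + 1)
    (PseudoRiemannianMetric.isGeodesicOn_const_line _ _ _ 0 v _)
  simpa [Function.comp_def] using
    ((PseudoRiemannianMetric.isGeodesicOn_const_iff _ _ _ _ _).1 h1).2 t (by simp)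

lemma fderiv_eq (hf : IsTotallyGeodesicFactorization h φ φS φI) (x : MinkowskiSpace d) :
    fderiv ℝ φS x = fderiv ℝ φS 0 := by
  have h1 := ((fderiv ℝ φS 0).hasFDerivAt (x := x)).const_add (φS 0)
  rw [← funext hf.apply_eq] at h1
  exact h1.fderiv

lemma exists_continuousAffineMap (hf : IsTotallyGeodesicFactorization h φ φS φI) :
    ∃ a : MinkowskiSpace d →ᴬ[ℝ] ℝ, φS = a := by
  refine ⟨ContinuousAffineMap.const ℝ _ (φS 0) + (fderiv ℝ φS 0).toContinuousAffineMap, ?_⟩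
  funext v
  rw [hf.apply_eq v]
  rfl

lemma isGeodesicOn_univ (hf : IsTotallyGeodesicFactorization h φ φS φI) :
    h.IsGeodesicOn φI univ := by
  refine ⟨hf.totallyGeodesic_snd.contMDiff.contMDiffOn, fun t _ e he hte ↦ ?_⟩
  have h1 := hf.totallyGeodesic_snd.map_geodesic (fun t ↦ 0 + t • (1 : ℝ)) (t - 1) (t + 1)
    (PseudoRiemannianMetric.isGeodesicOn_const_line _ _ _ 0 1 _)
  simp only [Function.comp_def, smul_eq_mul, mul_one, zero_add] at h1
  exact h1.geodesic_eq t (by simp) e he hte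

lemma minkowskiDifferentialSq_eq (hf : IsTotallyGeodesicFactorization h φ φS φI)
    (x : MinkowskiSpace d) : minkowskiDifferentialSq φS x = minkowskiDifferentialSq φS 0 := by
  rw [minkowskiDifferentialSq_def, minkowskiDifferentialSq_def, hf.fderiv_eq x]

/-- Injectivity of `dφI` makes the kernel of `dφS` the same for all factorizations. -/
lemma mfderiv_apply_eq_zero_iff (hf : IsTotallyGeodesicFactorization h φ φS φI)
    (x v : MinkowskiSpace d) :
    mfderiv 𝓘(ℝ, MinkowskiSpace d) 𝓘(ℝ, E) φ x v = 0 ↔ fderiv ℝ φS x v = 0 := by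
  rw [hf.eq_comp, mfderiv_comp x (hf.totallyGeodesic_snd.contMDiff.mdifferentiable (by simp) _)
    (hf.totallyGeodesic_fst.contMDiff.mdifferentiable (by simp) _), mfderiv_eq_fderiv]
  exact map_eq_zero_iff (mfderiv 𝓘(ℝ, ℝ) 𝓘(ℝ, E) φI (φS x)) (hf.immersion _)

/-- The first factors of two factorizations have proportional differentials. -/
lemma exists_minkowskiDifferentialSq_eq_mul (hf : IsTotallyGeodesicFactorization h φ φS φI)
    (hf' : IsTotallyGeodesicFactorization h φ φS' φI') (x : MinkowskiSpace d) :
    ∃ c : ℝ, 0 < c ∧ minkowskiDifferentialSq φS x = c * minkowskiDifferentialSq φS' x := by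
  have hiff : ∀ v : MinkowskiSpace d, fderiv ℝ φS x v = 0 ↔ fderiv ℝ φS' x v = 0 := fun v ↦
    (hf.mfderiv_apply_eq_zero_iff x v).symm.trans (hf'.mfderiv_apply_eq_zero_iff x v)
  obtain ⟨u, hu⟩ : ∃ u : MinkowskiSpace d, fderiv ℝ φS' x u = 1 := by
    have := hf'.submersion x
    rw [mfderiv_eq_fderiv] at this
    exact this 1
  have hc : fderiv ℝ φS x u ≠ 0 := fun h0 ↦ by simp [(hiff u).1 h0] at hu
  have heq : fderiv ℝ φS x = fderiv ℝ φS x u • fderiv ℝ φS' x := by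
    ext v
    -- As `dφS' u = 1`, this vector is in the common kernel, which yields the factor `dφS u`.
    have h1 := (hiff (v - fderiv ℝ φS' x v • u)).2 (by simp [hu])
    rw [map_sub, map_smul, sub_eq_zero] at h1
    simp [h1, mul_comm]
  refine ⟨fderiv ℝ φS x u * fderiv ℝ φS x u, mul_self_pos.2 hc, ?_⟩
  rw [minkowskiDifferentialSq_def, minkowskiDifferentialSq_def]
  -- The factor contains the left side of `heq`; naming it keeps rewriting with `heq` from looping.
  generalize fderiv ℝ φS x u = c at heq
  simp [heq, mul_assoc]

end IsTotallyGeodesicFactorization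

end Factorization

theorem mainTheorem3 (d : ℕ)
    {E : Type*} [NormedAddCommGroup E] [NormedSpace ℝ E] [FiniteDimensional ℝ E]
    {N : Type*} [TopologicalSpace N] [ChartedSpace E N] [IsManifold 𝓘(ℝ, E) ∞ N]
    (h : Bundle.ContMDiffRiemannianMetric 𝓘(ℝ, E) ∞ E (fun x : N ↦ TangentSpace 𝓘(ℝ, E) x))
    (φ : MinkowskiSpace d → N)
    (hφ : IsTotallyGeodesic (minkowskiMetric d) h.toPseudo φ)
    (hrank : ∀ x, Module.finrank ℝ
      (mfderiv 𝓘(ℝ, MinkowskiSpace d) 𝓘(ℝ, E) φ x).range = 1) :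
    (∃ φS φI, IsTotallyGeodesicFactorization h.toPseudo φ φS φI) ∧
    (∀ φS φI, IsTotallyGeodesicFactorization h.toPseudo φ φS φI →
      (∃ a : MinkowskiSpace d →ᴬ[ℝ] ℝ, φS = a) ∧
      h.toPseudo.IsGeodesicOn φI univ ∧
      ∃ c : ℝ, ∀ x, minkowskiDifferentialSq φS x = c) ∧
    ((IsTimeLike h.toPseudo φ ∧ ¬ IsNull h.toPseudo φ ∧ ¬ IsSpaceLike h.toPseudo φ) ∨
      (¬ IsTimeLike h.toPseudo φ ∧ IsNull h.toPseudo φ ∧ ¬ IsSpaceLike h.toPseudo φ) ∨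
      (¬ IsTimeLike h.toPseudo φ ∧ ¬ IsNull h.toPseudo φ ∧ IsSpaceLike h.toPseudo φ)) := by
  obtain ⟨φS, φI, hf⟩ := exists_isTotallyGeodesicFactorization hφ hrank
  refine ⟨⟨φS, φI, hf⟩, fun ψS ψI hψ ↦ ⟨hψ.exists_continuousAffineMap, hψ.isGeodesicOn_univ,
    _, hψ.minkowskiDifferentialSq_eq⟩, ?_⟩
  -- Each type is read off from one number, the value at `0` for one fixed factorization; trichotomy
  -- in `ℝ` then concludes.
  have hT : IsTimeLike h.toPseudo φ ↔ minkowskiDifferentialSq φS 0 < 0 := by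
    refine ⟨?_, fun hs ↦ ⟨φS, φI, hf, fun x ↦ by rwa [hf.minkowskiDifferentialSq_eq]⟩⟩
    rintro ⟨ψS, ψI, hψ, hs⟩
    obtain ⟨c, hc, hcs⟩ := hf.exists_minkowskiDifferentialSq_eq_mul hψ 0
    exact hcs ▸ mul_neg_of_pos_of_neg hc (hs 0)
  have hN : IsNull h.toPseudo φ ↔ minkowskiDifferentialSq φS 0 = 0 := by
    refine ⟨?_, fun hs ↦ ⟨φS, φI, hf, fun x ↦ by rwa [hf.minkowskiDifferentialSq_eq]⟩⟩
    rintro ⟨ψS, ψI, hψ, hs⟩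
    obtain ⟨c, hc, hcs⟩ := hf.exists_minkowskiDifferentialSq_eq_mul hψ 0
    rw [hcs, hs 0, mul_zero]
  have hS : IsSpaceLike h.toPseudo φ ↔ 0 < minkowskiDifferentialSq φS 0 := by
    refine ⟨?_, fun hs ↦ ⟨φS, φI, hf, fun x ↦ by rwa [hf.minkowskiDifferentialSq_eq]⟩⟩
    rintro ⟨ψS, ψI, hψ, hs⟩
    obtain ⟨c, hc, hcs⟩ := hf.exists_minkowskiDifferentialSq_eq_mul hψ 0
    exact hcs ▸ mul_pos hc (hs 0)
  rw [hT, hN, hS]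
  rcases lt_trichotomy (minkowskiDifferentialSq φS 0) 0 with hs | hs | hs
  · exact Or.inl ⟨hs, hs.ne, hs.le.not_gt⟩
  · exact Or.inr (Or.inl ⟨hs.ge.not_gt, hs, hs.le.not_gt⟩)
  · exact Or.inr (Or.inr ⟨hs.le.not_gt, hs.ne', hs⟩)
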